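/- Let $A$ be a (not necessarily finite or commutative) ring with $1\neq 0$, endowed with an involution $*$, i.e. an anti-automorphism of order at most $2$, let $F$ be a field, and let $n\ge 1$. Let $V$ be a free right $A$-module with basis $u_1,\dots,u_n,v_1,\dots,v_n$, and let $h:V\times V\to A$ be the skew-hermitian form, linear in the second variable, with Gram matrix $\begin{pmatrix}0&1_n\\-1_n&0\end{pmatrix}$ in this basis. Let $U$ be the group of all automorphisms of the right $A$-module $V$ preserving $h$, and let $M$ and $N$ be the $A$-spans of $u_1,\dots,u_n$ and of $v_1,\dots,v_n$. Let $C$ be the pointwise stabilizer of $M$ in $U$, let $L$ be the group of all $g\in U$ stabilizing $M$ and $N$ with $gu_i-u_i\in\langle u_1,\dots,u_{i-1}\rangle$ for $1\le i\le n$, and put $P=C\rtimes L$. (Thus $C$ is isomorphic to the additive group of $n\times n$ hermitian matrices over $A$, and $L$ to the group of $n\times n$ upper unitriangular matrices over $A$.) A linear character $\lambda:A^+\to F^*$ is called left admissible if the kernel of the linear character $\lambda^\sharp:A^+\to F^*$, $\lambda^\sharp(a)=\lambda(a+a^*)$, contains no left ideal of $A$ other than $(0)$. For $1\le i\le n$ and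 a linear character $\lambda:A^+\to F^*$ let $L_{v_i}$ be the stabilizer of $v_i$ in $L$, let $W_{i,\lambda}$ be the one-dimensional $F$-space on which $C\rtimes L_{v_i}$ acts through the linear character $g\mapsto\lambda(h(gv_i,v_i))$, and let $V_{i,\lambda}=\operatorname{ind}_{C\rtimes L_{v_i}}^{P}W_{i,\lambda}$ be the induced module $F[P]\otimes_{F[C\rtimes L_{v_i}]}W_{i,\lambda}$. **Theorem 5.1.** Let $D$ be a non-empty subset of $\{1,\dots,n\}$ and, for each $i\in D$, let $\lambda_i:A^+\to F^*$ be a left admissible linear character. Then the tensor product over $F$ $$V(D,\lambda)=\bigotimes_{i\in D}V_{i,\lambda_i},$$ with the diagonal action of $P$, is an irreducible $P$-module, and $(V(D,\lambda),V(D,\lambda))_P:=\dim_F\operatorname{Hom}_P(V(D,\lambda),V(D,\lambda))=1$; that is, its only $P$-endomorphisms are the scalars from $F$. -/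

import Mathlib

namespace HermitianUnipotent

variable (n : ℕ) (A : Type*) [Ring A]

/-- The free right `A`-module of rank `2n` (right `A`-modules are modules over `Aᵐᵒᵖ`).
The index `Sum.inl i` belongs to the basis vector `u i`, and `Sum.inr i` to `v i`. -/
abbrev Space : Type _ := Fin n ⊕ Fin n → A

/-- `GL(V_A)`: the automorphisms of the right `A`-module `Space n A`. -/
abbrev GLSpace : Type _ := Space n A ≃ₗ[Aᵐᵒᵖ] Space n A

variable {n A}

/-- The basis vectors `u₁, …, uₙ`. -/
def u (i : Fin n) : Space n A := Pi.single (Sum.inl i) 1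

/-- The basis vectors `v₁, …, vₙ`. -/
def v (i : Fin n) : Space n A := Pi.single (Sum.inr i) 1

variable (n A)

/-- `M = ⟨u₁, …, uₙ⟩`. -/
def M : Submodule Aᵐᵒᵖ (Space n A) := Submodule.span Aᵐᵒᵖ (Set.range u)

/-- `N = ⟨v₁, …, vₙ⟩`. -/
def N : Submodule Aᵐᵒᵖ (Space n A) := Submodule.span Aᵐᵒᵖ (Set.range v)

variable {n}

/-- The span of the vectors `u j` with `j < i`. -/
def flag (i : Fin n) : Submodule Aᵐᵒᵖ (Space n A) :=
  Submodule.span Aᵐᵒᵖ (u '' {j : Fin n | j < i})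

variable {A}

theorem u_mem_flag {i j : Fin n} (hij : j < i) : (u j : Space n A) ∈ flag A i :=
  Submodule.subset_span ⟨j, hij, rfl⟩

theorem flag_mono {i j : Fin n} (hij : j ≤ i) : flag A j ≤ flag A i :=
  Submodule.span_mono (Set.image_mono fun _ hk => lt_of_lt_of_le hk hij)

theorem map_flag {g : GLSpace n A} (hg : ∀ i, g (u i) - u i ∈ flag A i) (i : Fin n)
    {x : Space n A} (hx : x ∈ flag A i) : g x ∈ flag A i := by
  have : flag A i ≤ (flag A i).comap (g : Space n A →ₗ[Aᵐᵒᵖ] Space n A) := by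
    refine Submodule.span_le.2 ?_
    rintro _ ⟨j, hj, rfl⟩
    have h2 := add_mem (flag_mono (le_of_lt hj) (hg j)) (u_mem_flag (A := A) hj)
    simpa using h2
  exact this hx

theorem inv_sub_mem_flag {g : GLSpace n A} (hg : ∀ i, g (u i) - u i ∈ flag A i) (i : Fin n) :
    g⁻¹ (u i) - u i ∈ flag A i := by
  induction i using WellFoundedLT.induction with
  | ind i ih =>
    have hinv : flag A i ≤ (flag A i).comap ((g⁻¹ : GLSpace n A) : Space n A →ₗ[Aᵐᵒᵖ] Space n A) := by
      refine Submodule.span_le.2 ?_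
      rintro _ ⟨j, hj, rfl⟩
      have h2 := add_mem (flag_mono (le_of_lt hj) (ih j hj)) (u_mem_flag (A := A) hj)
      simpa using h2
    have h3 : g⁻¹ (g (u i) - u i) ∈ flag A i := hinv (hg i)
    rw [map_sub, ← LinearEquiv.mul_apply, inv_mul_cancel, LinearEquiv.coe_one, id] at h3
    simpa using neg_mem h3

theorem M_apply_inr {x : Space n A} (hx : x ∈ M n A) (i : Fin n) : x (Sum.inr i) = 0 := by
  induction hx using Submodule.span_induction with
  | mem x hx => obtain ⟨j, rfl⟩ := hx; simp [u]
  | zero => rfl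
  | add x y _ _ hx hy => simp [hx, hy]
  | smul a x _ hx => simp [hx]

theorem mem_M_iff {x : Space n A} : x ∈ M n A ↔ ∀ i, x (Sum.inr i) = 0 := by
  refine ⟨M_apply_inr, fun hx => ?_⟩
  have : x = ∑ i : Fin n, MulOpposite.op (x (Sum.inl i)) • u i := by
    ext j
    rcases j with j | j
    · simp [u, Finset.sum_apply, Pi.single_apply]
    · simp [u, Finset.sum_apply, hx]
  rw [this]
  exact sum_mem fun i _ => Submodule.smul_mem _ _ (Submodule.subset_span ⟨i, rfl⟩)

variable [StarRing A]

/-- The skew-hermitian form on `Space n A` whose Gram matrix with respect to the basis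
`u₁, …, uₙ, v₁, …, vₙ` is `[0, 1; -1, 0]`. It is linear in the second variable. -/
def h (x y : Space n A) : A :=
  ∑ i : Fin n, (star (x (Sum.inl i)) * y (Sum.inr i) - star (x (Sum.inr i)) * y (Sum.inl i))

theorem h_add_left (x x' y : Space n A) : h (x + x') y = h x y + h x' y := by
  simp only [h, ← Finset.sum_add_distrib, Pi.add_apply, star_add, add_mul]
  exact Finset.sum_congr rfl fun _ _ => by abel

theorem h_add_right (x y y' : Space n A) : h x (y + y') = h x y + h x y' := by
  simp only [h, ← Finset.sum_add_distrib, Pi.add_apply, mul_add]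
  exact Finset.sum_congr rfl fun _ _ => by abel

theorem h_smul_right (x y : Space n A) (a : A) :
    h x (MulOpposite.op a • y) = h x y * a := by
  simp only [h, Finset.sum_mul, Pi.smul_apply, MulOpposite.smul_eq_mul_unop,
    MulOpposite.unop_op, sub_mul, mul_assoc]

theorem h_skew (x y : Space n A) : h y x = -star (h x y) := by
  simp only [h, star_sum, star_sub, star_mul, star_star, ← Finset.sum_neg_distrib]
  exact Finset.sum_congr rfl fun _ _ => by abel

variable (n A)

/-- The group `U` of all automorphisms of the right module that preserve `h`. -/
def isometryGroup : Subgroup (GLSpace n A) where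
  carrier := {g | ∀ x y, h (g x) (g y) = h x y}
  one_mem' := fun _ _ => rfl
  mul_mem' := fun {a b} ha hb x y => (ha (b x) (b y)).trans (hb x y)
  inv_mem' := fun {a} ha x y => by
    have := ha (a⁻¹ x) (a⁻¹ y)
    rwa [← LinearEquiv.mul_apply, ← LinearEquiv.mul_apply, mul_inv_cancel,
      LinearEquiv.coe_one, id, id, eq_comm] at this

/-- `C`: the pointwise stabilizer of `M` in `U`. -/
def C : Subgroup (GLSpace n A) :=
  isometryGroup n A ⊓ fixingSubgroup (GLSpace n A) (M n A : Set (Space n A))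

/-- `T`: the global stabilizer of `M` and `N` in `U`. -/
def T : Subgroup (GLSpace n A) where
  carrier := {g | g ∈ isometryGroup n A ∧
    (∀ x, g x ∈ M n A ↔ x ∈ M n A) ∧ (∀ x, g x ∈ N n A ↔ x ∈ N n A)}
  one_mem' := ⟨one_mem _, fun _ => Iff.rfl, fun _ => Iff.rfl⟩
  mul_mem' := fun {a b} ha hb => ⟨mul_mem ha.1 hb.1,
    fun x => (ha.2.1 (b x)).trans (hb.2.1 x), fun x => (ha.2.2 (b x)).trans (hb.2.2 x)⟩
  inv_mem' := fun {a} ha => by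
    have key : ∀ x, a (a⁻¹ x) = x := fun x => by
      rw [← LinearEquiv.mul_apply, mul_inv_cancel, LinearEquiv.coe_one, id]
    refine ⟨inv_mem ha.1, fun x => ?_, fun x => ?_⟩
    · rw [← ha.2.1, key]
    · rw [← ha.2.2, key]

/-- `L`: the elements of `T` that are unitriangular on `u₁, …, uₙ`. -/
def L : Subgroup (GLSpace n A) where
  carrier := {g | g ∈ T n A ∧ ∀ i, g (u i) - u i ∈ flag A i}
  one_mem' := ⟨one_mem _, fun i => by simp⟩
  mul_mem' := fun {a b} ha hb => ⟨mul_mem ha.1 hb.1, fun i => by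
    have := add_mem (map_flag ha.2 i (hb.2 i)) (ha.2 i)
    rw [map_sub] at this
    simpa using this⟩
  inv_mem' := fun {a} ha => ⟨inv_mem ha.1, inv_sub_mem_flag ha.2⟩

/-- `P = C ⋊ L`, as an internal semidirect product: the subgroup of `U` generated by `C` and `L`
(`L` normalizes `C` and meets it trivially). -/
def P : Subgroup (GLSpace n A) := C n A ⊔ L n A

variable {n A}

/-- `L_x`: the stabilizer of the vector `x` in `L`. -/
def Lstab (x : Space n A) : Subgroup (GLSpace n A) :=
  L n A ⊓ MulAction.stabilizer (GLSpace n A) x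

/-- `C ⋊ L_x`, as an internal semidirect product. -/
def CLstab (x : Space n A) : Subgroup (GLSpace n A) := C n A ⊔ Lstab x

theorem CLstab_le_P (x : Space n A) : CLstab x ≤ P n A := sup_le_sup_left inf_le_left _

theorem h_eq_zero_of_mem_M {x y : Space n A} (hx : x ∈ M n A) (hy : y ∈ M n A) : h x y = 0 := by
  simp [h, M_apply_inr hx, M_apply_inr hy]

theorem h_v_self (i : Fin n) : h (v i : Space n A) (v i) = 0 := by
  simp [h, v]

theorem C_sub_mem {g : GLSpace n A} (hg : g ∈ C n A) (x : Space n A) : g x - x ∈ M n A := by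
  rw [mem_M_iff]
  intro i
  have hu : g (u i) = u i := (mem_fixingSubgroup_iff _).1 hg.2 (u i)
    (Submodule.subset_span ⟨i, rfl⟩)
  have h1 := hg.1 (u i) x
  rw [hu] at h1
  have h2 : ∀ y : Space n A, h (u i) y = y (Sum.inr i) := fun y => by
    simp only [h, u]
    rw [Finset.sum_eq_single i]
    · simp
    · intro j _ hj
      simp [hj]
    · simp
  rw [h2, h2] at h1
  rw [Pi.sub_apply, h1, sub_self]

/-- The properties of the elements of `C ⋊ L_x` that make `g ↦ λ(h(gx, x))` multiplicative. -/
theorem CLstab_spec (x : Space n A) {g : GLSpace n A} (hg : g ∈ CLstab x) :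
    g ∈ isometryGroup n A ∧ (∀ y ∈ M n A, g y ∈ M n A) ∧ g x - x ∈ M n A := by
  have key : ∀ g : GLSpace n A, g ∈ ((C n A : Set (GLSpace n A)) ∪ Lstab x) →
      g ∈ isometryGroup n A ∧ (∀ y ∈ M n A, g y ∈ M n A) ∧ g x - x ∈ M n A := by
    rintro g (hg | hg)
    · refine ⟨hg.1, fun y hy => ?_, C_sub_mem hg x⟩
      have : g y = y := (mem_fixingSubgroup_iff _).1 hg.2 y hy
      rwa [this]
    · refine ⟨hg.1.1.1, fun y hy => (hg.1.1.2.1 y).2 hy, ?_⟩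
      have : g x = x := hg.2
      simp [this]
  rw [CLstab, Subgroup.sup_eq_closure] at hg
  induction hg using Subgroup.closure_induction'' with
  | mem g hg => exact key g hg
  | inv_mem g hg =>
    exact key g⁻¹ (Or.imp (fun a => (C n A).inv_mem a) (fun a => (Lstab x).inv_mem a) hg)
  | one => exact ⟨one_mem _, fun _ hy => hy, by simp⟩
  | mul a b _ _ ha hb =>
    refine ⟨mul_mem ha.1 hb.1, fun y hy => ha.2.1 _ (hb.2.1 y hy), ?_⟩
    have := add_mem (ha.2.1 _ hb.2.2) ha.2.2
    rw [map_sub] at this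
    simpa using this

theorem h_mul_v (i : Fin n) {g k : GLSpace n A} (hg : g ∈ CLstab (v i)) (hk : k ∈ CLstab (v i)) :
    h ((g * k) (v i)) (v i) = h (g (v i)) (v i) + h (k (v i)) (v i) := by
  obtain ⟨hU, hM, hv⟩ := CLstab_spec _ hg
  obtain ⟨-, -, hv'⟩ := CLstab_spec _ hk
  set w : Space n A := k (v i) - v i with hw
  set z : Space n A := g (v i) - v i with hz
  have e1 : k (v i) = v i + w := by rw [hw]; abel
  have e2 : g (v i) = v i + z := by rw [hz]; abel
  have e3 : h (g w) (v i) = h w (v i) := by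
    have h1 := hU w (v i)
    rw [e2, h_add_right, h_eq_zero_of_mem_M (hM w hv') hv, add_zero] at h1
    exact h1
  rw [LinearEquiv.mul_apply, e1, map_add, h_add_left, e3, h_add_left (v i) w, h_v_self, zero_add]

variable {F : Type*} [Field F]

/-- The linear character `λ♯(a) = λ(a + a*)`. -/
def sharp (lam : AddChar A Fˣ) : AddChar A Fˣ where
  toFun a := lam (a + star a)
  map_zero_eq_one' := by simp
  map_add_eq_mul' a b := by
    rw [← AddChar.map_add_eq_mul, star_add]
    congr 1
    abel

/-- `λ` is left admissible: the kernel of `λ♯` contains no left ideal except `0`. -/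
def LeftAdmissible (lam : AddChar A Fˣ) : Prop :=
  ∀ I : Ideal A, (∀ a ∈ I, sharp lam a = 1) → I = ⊥

/-- The linear character `g ↦ λ(h(g vᵢ, vᵢ))` of `C ⋊ L_{vᵢ}`. -/
def chi (i : Fin n) (lam : AddChar A Fˣ) : CLstab (v i : Space n A) →* Fˣ where
  toFun g := lam (h ((g : GLSpace n A) (v i)) (v i))
  map_one' := by
    have : h (((1 : CLstab (v i : Space n A)) : GLSpace n A) (v i)) (v i) = 0 := h_v_self i
    rw [this, AddChar.map_zero_eq_one]
  map_mul' g k := by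
    rw [Subgroup.coe_mul, h_mul_v i g.2 k.2, AddChar.map_add_eq_mul]

/-- The one-dimensional module `Wᵢ = F` on which `C ⋊ L_{vᵢ}` acts through `chi i lam`. -/
def W (i : Fin n) (lam : AddChar A Fˣ) : Representation F (CLstab (v i : Space n A)) F :=
  (DistribMulAction.toModuleEnd F F).comp (chi i lam)

/-- The `P`-module `V_{i,λ}` induced from the module `Wᵢ` of `C ⋊ L_{vᵢ}`. -/
noncomputable def V (i : Fin n) (lam : AddChar A Fˣ) :
    Representation F (P n A)
      (Representation.IndV (Subgroup.inclusion (CLstab_le_P (v i : Space n A))) (W i lam)) :=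
  Representation.ind (Subgroup.inclusion (CLstab_le_P (v i : Space n A))) (W i lam)

/-- The tensor product `V(D,λ) = ⨂_{i ∈ D} V_{i,λᵢ}` with the diagonal action of `P`. -/
noncomputable def VD (D : Finset (Fin n)) (lam : D → AddChar A Fˣ) :
    Representation F (P n A)
      (PiTensorProduct F fun i : D =>
        Representation.IndV (Subgroup.inclusion (CLstab_le_P (v i.1 : Space n A)))
          (W i.1 (lam i))) :=
  PiTensorProduct.mapMonoidHom.comp (MonoidHom.pi fun i : D => V i.1 (lam i))

end HermitianUnipotent

/-!
The module `V i lam` has a basis indexed by the orbit of `v i` under `L`, which consists of the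
vectors `w = v i + ∑ j > i, v j * x j` (`basisV`). The group `L` permutes this basis as it permutes
the orbit, and `c` in `C` multiplies the basis vector at `w` by `lam (h (c w) w)`. The tensor
product therefore has a basis indexed by the families `(w i)`, `i ∈ D`, on which `C` acts diagonally
through the characters `weight lam w`. Two facts finish the proof.

* The weights are pairwise distinct (`weight_injective`). For the first `i` at which `w` and `w'`
  could differ, the elements of `C` whose hermitian matrix is `a` at `(i, j)` and `star a` at
  `(j, i)` show that `sharp (lam i)` is trivial on the left ideal generated by the difference of the
  `j`-th coordinates of `w i` and `w' i`; by left admissibility this difference is zero.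
* `L` is transitive on the families `w`, since the columns of a unitriangular matrix can be chosen
  independently (`exists_forall_apply_v`).

So every non-zero submodule contains a weight vector, hence all of them
(`Representation.isIrreducible_of_weights`), and an endomorphism preserves every weight line and acts
on all of them by one scalar (`Representation.rank_intertwiningMap_of_weights`). This works over
every field, for infinite `A` as well.
-/

namespace Representation

/-! ### Monomial representations with distinct weights -/

section Weights

variable {F G V ι : Type*} [Field F] [Group G] [AddCommGroup V] [Module F V]
  {ρ : Representation F G V} {S : Set G} {χ : ι → G → F}

theorem repr_apply_of_weights (b : Module.Basis ι F V)
    (hχ : ∀ c ∈ S, ∀ x, ρ c (b x) = χ x c • b x) {c : G} (hc : c ∈ S) (w : V) (z : ι) :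
    b.repr (ρ c w) z = χ z c * b.repr w z := by
  have : b.coord z ∘ₗ ρ c = χ z c • b.coord z := by
    refine b.ext fun x => ?_
    by_cases hxz : x = z
    · subst hxz
      simp [hχ c hc]
    · simp [hχ c hc, Finsupp.single_eq_of_ne' hxz]
  exact LinearMap.congr_fun this w

/-- A non-zero invariant subspace of a module with pairwise distinct weights contains a weight
vector: a non-zero vector of the subspace with the fewest non-zero coordinates has only one of
them, since `ρ c w - χ x c • w` loses the coordinate at `x` and keeps every coordinate whose weight
differs from `χ x` at `c`. -/
theorem exists_basis_mem_of_weights (b : Module.Basis ι F V)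
    (hχ : ∀ c ∈ S, ∀ x, ρ c (b x) = χ x c • b x)
    (hinj : ∀ x y, (∀ c ∈ S, χ x c = χ y c) → x = y)
    (N : Subrepresentation ρ) (m : ℕ) :
    ∀ w ∈ N, w ≠ 0 → (b.repr w).support.card = m → ∃ x, b x ∈ N := by
  induction m using Nat.strong_induction_on with
  | _ m ih =>
    intro w hwN hw0 hcard
    have hne : (b.repr w).support.Nonempty := by simpa using hw0
    obtain ⟨x, hx⟩ := hne
    by_cases hsub : ∀ y ∈ (b.repr w).support, y = x
    · refine ⟨x, ?_⟩
      have hrepr : b.repr w = Finsupp.single x (b.repr w x) := by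
        ext y
        by_cases hy : y = x
        · simp [hy]
        · rw [Finsupp.single_eq_of_ne hy]
          by_contra h0
          exact hy (hsub y (Finsupp.mem_support_iff.2 h0))
      have hw : w = b.repr w x • b x := by
        apply b.repr.injective
        rw [map_smul, b.repr_self, Finsupp.smul_single_one, ← hrepr]
      have := N.toSubmodule.smul_mem (b.repr w x)⁻¹ hwN
      rw [hw] at this
      rwa [map_smul, b.repr_self, Finsupp.smul_apply, Finsupp.single_eq_same, smul_eq_mul, mul_one,
        smul_smul, inv_mul_cancel₀ (Finsupp.mem_support_iff.1 hx), one_smul] at this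
    · push Not at hsub
      obtain ⟨y, hy, hyx⟩ := hsub
      obtain ⟨c, hc, hcne⟩ : ∃ c ∈ S, χ y c ≠ χ x c := by
        by_contra! hall
        exact hyx (hinj y x hall)
      have hcoord : ∀ z, b.repr (ρ c w - χ x c • w) z = (χ z c - χ x c) * b.repr w z := by
        intro z
        rw [map_sub, map_smul, Finsupp.sub_apply, Finsupp.smul_apply, smul_eq_mul,
          repr_apply_of_weights b hχ hc, sub_mul]
      refine ih _ ?_ (ρ c w - χ x c • w)
        (N.toSubmodule.sub_mem (N.apply_mem_toSubmodule c hwN) (N.toSubmodule.smul_mem _ hwN))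
        ?_ rfl
      · rw [← hcard]
        refine Finset.card_lt_card ⟨fun z hz => ?_, fun hle => ?_⟩
        · rw [Finsupp.mem_support_iff, hcoord] at hz
          exact Finsupp.mem_support_iff.2 (right_ne_zero_of_mul hz)
        · have := hle hx
          rw [Finsupp.mem_support_iff, hcoord, sub_self, zero_mul] at this
          exact this rfl
      · intro h0
        have := hcoord y
        rw [h0, map_zero, Finsupp.zero_apply] at this
        exact mul_ne_zero (sub_ne_zero.2 hcne) (Finsupp.mem_support_iff.1 hy) this.symm

/-- A representation with a basis of weight vectors for a set `S` of group elements, whose weights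
are pairwise distinct and whose basis vectors form a single orbit, is irreducible. -/
theorem isIrreducible_of_weights (b : Module.Basis ι F V)
    (hχ : ∀ c ∈ S, ∀ x, ρ c (b x) = χ x c • b x)
    (hinj : ∀ x y, (∀ c ∈ S, χ x c = χ y c) → x = y)
    (x₀ : ι) (htrans : ∀ x, ∃ g, ρ g (b x₀) = b x) : ρ.IsIrreducible := by
  have hnt : Nontrivial (Subrepresentation ρ) := by
    refine ⟨⊥, ⊤, fun heq => b.ne_zero x₀ ?_⟩
    have : b x₀ ∈ (⊤ : Subrepresentation ρ) := Submodule.mem_top (R := F)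
    rw [← heq] at this
    exact (Submodule.mem_bot F).1 this
  refine ⟨fun N => or_iff_not_imp_left.2 fun hN => ?_⟩
  obtain ⟨w, hwN, hw0⟩ : ∃ w ∈ N.toSubmodule, w ≠ 0 := by
    refine (Submodule.ne_bot_iff _).1 fun h0 => hN ?_
    exact Subrepresentation.toSubmodule_injective h0
  obtain ⟨x, hx⟩ := exists_basis_mem_of_weights b hχ hinj N _ w hwN hw0 rfl
  have hx₀ : b x₀ ∈ N := by
    obtain ⟨g, hg⟩ := htrans x
    have := N.apply_mem_toSubmodule g⁻¹ hx
    rwa [← hg, ρ.inv_self_apply] at this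
  apply Subrepresentation.toSubmodule_injective
  refine top_le_iff.1 (b.span_eq ▸ Submodule.span_le.2 ?_)
  rintro _ ⟨y, rfl⟩
  obtain ⟨g, hg⟩ := htrans y
  rw [← hg]
  exact N.apply_mem_toSubmodule g hx₀

/-- Under the hypotheses of `isIrreducible_of_weights` the only endomorphisms are the scalars, over
any field: an endomorphism preserves the weight lines, and it acts on all of them by the same scalar
because the group permutes them transitively. -/
theorem rank_intertwiningMap_of_weights (b : Module.Basis ι F V)
    (hχ : ∀ c ∈ S, ∀ x, ρ c (b x) = χ x c • b x)
    (hinj : ∀ x y, (∀ c ∈ S, χ x c = χ y c) → x = y)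
    (x₀ : ι) (htrans : ∀ x, ∃ g, ρ g (b x₀) = b x) :
    Module.rank F (IntertwiningMap ρ ρ) = 1 := by
  refine rank_eq_one (1 : IntertwiningMap ρ ρ) ?_ fun f => ?_
  · intro h1
    have : (1 : IntertwiningMap ρ ρ) (b x₀) = 0 := by rw [h1]; rfl
    exact b.ne_zero x₀ this
  · refine ⟨b.repr (f (b x₀)) x₀, ?_⟩
    have hline : f (b x₀) = b.repr (f (b x₀)) x₀ • b x₀ := by
      apply b.repr.injective
      ext z
      rw [map_smul, b.repr_self, Finsupp.smul_single_one]
      by_cases hz : z = x₀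
      · simp [hz]
      · rw [Finsupp.single_eq_of_ne hz]
        obtain ⟨c, hc, hcne⟩ : ∃ c ∈ S, χ z c ≠ χ x₀ c := by
          by_contra! hall
          exact hz (hinj z x₀ hall)
        have h1 := repr_apply_of_weights b hχ hc (f (b x₀)) z
        rw [← f.isIntertwining, hχ c hc, map_smul, map_smul, Finsupp.smul_apply, smul_eq_mul,
          ← sub_eq_zero, ← sub_mul] at h1
        exact (mul_eq_zero.1 h1).resolve_left (sub_ne_zero.2 hcne.symm)
    apply IntertwiningMap.ext
    refine b.ext fun x => ?_
    obtain ⟨g, hg⟩ := htrans x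
    change b.repr (f (b x₀)) x₀ • b x = f (b x)
    rw [← hg, f.isIntertwining, ← map_smul, ← hline]

end Weights

/-! ### A basis of a module induced from a linear character -/

section Induced

open scoped MonoidAlgebra

variable {k G H ι : Type*} [CommRing k] [Group G] [Group H] (φ : H →* G)
  (ρ : Representation k H k)

theorem IndV.mk_map_mul (g : G) (t : H) (a : k) :
    IndV.mk φ ρ (φ t * g) (ρ t a) = IndV.mk φ ρ g a := by
  have := Coinvariants.mk_self_apply (tprod ((leftRegular k G).comp φ) ρ) t
    (TensorProduct.tmul k (MonoidAlgebra.single g 1) a)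
  simpa using this

variable {ρ} {χ : H →* kˣ} (hρ : ∀ t a, ρ t a = χ t * a) (e : ι × H ≃ G)

/-- The coordinates of `IndV φ ρ`, for `ρ` one-dimensional with character `χ`, with respect to a
transversal `s : ι → G`, where `e (x, t) = s x * φ t`. As Mathlib's `ind` lets `G` act on
`k[G]` through `g₁ ↦ g₁ * g⁻¹`, the coordinates of `g ⊗ 1` are read off from `g⁻¹`. -/
noncomputable def IndV.toFinsupp (he : ∀ x t t', e (x, t * t') = e (x, t) * φ t') :
    IndV φ ρ →ₗ[k] ι →₀ k :=
  Coinvariants.lift _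
    (TensorProduct.lift <| (Finsupp.lift _ _ _ fun g =>
      Finsupp.lsingle (e.symm g⁻¹).1 ∘ₗ
        LinearMap.lsmul k k (χ (e.symm g⁻¹).2 : k)) ∘ₗ
      (MonoidAlgebra.coeffLinearEquiv k).toLinearMap)
    fun t₀ => by
      refine TensorProduct.ext <| MonoidAlgebra.lhom_ext' fun g => ?_
      obtain ⟨⟨x, t⟩, hg⟩ := e.surjective g⁻¹
      have h2 : e (x, t) * (φ t₀)⁻¹ = e (x, t * t₀⁻¹) := by rw [he, map_inv]
      refine LinearMap.ext_ring (LinearMap.ext_ring ?_)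
      simp [hρ, h2, ← hg]

theorem IndV.toFinsupp_mk (he : ∀ x t t', e (x, t * t') = e (x, t) * φ t') (x : ι) (t : H) (a : k) :
    IndV.toFinsupp φ hρ e he (IndV.mk φ ρ (e (x, t))⁻¹ a) = Finsupp.single x (χ t * a) := by
  simp [IndV.toFinsupp]

/-- A transversal `s` of `φ(H)` in `G` gives the basis `s x ⊗ 1` of the module induced from a
one-dimensional representation of `H`. -/
noncomputable def IndV.basis (s : ι → G) (he : ∀ x t, e (x, t) = s x * φ t) :
    Module.Basis ι k (IndV φ ρ) :=
  have he' : ∀ x t t', e (x, t * t') = e (x, t) * φ t' := fun x t t' => by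
    rw [he, he, map_mul, mul_assoc]
  .ofRepr <| LinearEquiv.ofLinearMap (IndV.toFinsupp φ hρ e he')
    (Finsupp.lift _ _ _ fun x => IndV.mk φ ρ (s x)⁻¹ 1)
    (by
      ext x : 2
      have h1 := IndV.toFinsupp_mk φ hρ e he' x 1 1
      have h2 : e (x, 1) = s x := by rw [he, map_one, mul_one]
      rw [h2] at h1
      simpa using h1)
    (by
      refine IndV.hom_ext φ ρ fun g => ?_
      obtain ⟨⟨x, t⟩, hg⟩ := e.surjective g⁻¹
      ext
      have h1 := IndV.toFinsupp_mk φ hρ e he' x t 1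
      have h3 := IndV.mk_map_mul φ ρ ((s x * φ t)⁻¹) t 1
      rw [mul_inv_rev, mul_inv_cancel_left, hρ] at h3
      obtain rfl : g = (e (x, t))⁻¹ := by rw [hg, inv_inv]
      rw [LinearMap.comp_apply, LinearMap.comp_apply, h1, LinearMap.id_comp, he, mul_inv_rev,
        ← h3]
      simp only [Finsupp.lift_apply]
      rw [Finsupp.sum_single_index (by simp), ← map_smul, smul_eq_mul, mul_one])

theorem IndV.basis_apply (s : ι → G) (he : ∀ x t, e (x, t) = s x * φ t) (x : ι) :
    IndV.basis φ hρ e s he x = IndV.mk φ ρ (s x)⁻¹ 1 := by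
  change (Finsupp.lift _ _ _ fun x => IndV.mk φ ρ (s x)⁻¹ 1) (Finsupp.single x 1) = _
  simp only [Finsupp.lift_apply]
  rw [Finsupp.sum_single_index (by simp), one_smul]

theorem ind_basis (s : ι → G) (he : ∀ x t, e (x, t) = s x * φ t) {g : G} {x y : ι} {t : H}
    (hg : g * s x = s y * φ t) :
    ind φ ρ g (IndV.basis φ hρ e s he x) = (χ t : k) • IndV.basis φ hρ e s he y := by
  have h3 := IndV.mk_map_mul φ ρ ((s y * φ t)⁻¹) t 1
  rw [mul_inv_rev, mul_inv_cancel_left, hρ] at h3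
  rw [IndV.basis_apply, IndV.basis_apply, ind_mk, ← mul_inv_rev, hg, mul_inv_rev, ← h3, ← map_smul,
    smul_eq_mul, mul_one]

end Induced

end Representation

namespace HermitianUnipotent

variable {n : ℕ} {A : Type*} [Ring A]

/-! ### Elements of `L` and `C` -/

theorem u_apply_inl (i j : Fin n) : (u i : Space n A) (Sum.inl j) = if j = i then 1 else 0 := by
  simp [u, Pi.single_apply]

theorem u_apply_inr (i j : Fin n) : (u i : Space n A) (Sum.inr j) = 0 := by
  simp [u]

theorem v_apply_inl (i j : Fin n) : (v i : Space n A) (Sum.inl j) = 0 := by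
  simp [v]

theorem v_apply_inr (i j : Fin n) : (v i : Space n A) (Sum.inr j) = if j = i then 1 else 0 := by
  simp [v, Pi.single_apply]

theorem mem_N_iff {x : Space n A} : x ∈ N n A ↔ ∀ i, x (Sum.inl i) = 0 := by
  refine ⟨fun hx i => ?_, fun hx => ?_⟩
  · induction hx using Submodule.span_induction with
    | mem x hx => obtain ⟨j, rfl⟩ := hx; exact v_apply_inl j i
    | zero => rfl
    | add x y _ _ hx hy => simp [hx, hy]
    | smul a x _ hx => simp [hx]
  · have : x = ∑ i : Fin n, MulOpposite.op (x (Sum.inr i)) • v i := by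
      ext j
      rcases j with j | j
      · simp [v_apply_inl, Finset.sum_apply, hx]
      · simp [v_apply_inr, Finset.sum_apply]
    rw [this]
    exact sum_mem fun i _ => Submodule.smul_mem _ _ (Submodule.subset_span ⟨i, rfl⟩)

theorem flag_apply_inl {i k : Fin n} (hik : i ≤ k) {x : Space n A} (hx : x ∈ flag A i) :
    x (Sum.inl k) = 0 := by
  induction hx using Submodule.span_induction with
  | mem x hx =>
    obtain ⟨j, hj, rfl⟩ := hx
    rw [u_apply_inl, if_neg (lt_of_lt_of_le hj hik).ne']
  | zero => rfl
  | add x y _ _ hx hy => simp [hx, hy]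
  | smul a x _ hx => simp [hx]

variable (A) in
/-- The orbit of `v i` under `L`: the vectors `v i + ∑ j > i, v j * x j`. -/
def orbitV (i : Fin n) : Set (Space n A) :=
  {w | w ∈ N n A ∧ w (Sum.inr i) = 1 ∧ ∀ k < i, w (Sum.inr k) = 0}

theorem v_mem_orbitV (i : Fin n) : (v i : Space n A) ∈ orbitV A i :=
  ⟨mem_N_iff.2 (v_apply_inl i), by rw [v_apply_inr, if_pos rfl],
    fun k hk => by rw [v_apply_inr, if_neg hk.ne]⟩

variable [StarRing A]

theorem h_v_right (x : Space n A) (i : Fin n) : h x (v i) = star (x (Sum.inl i)) := by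
  simp [h, v_apply_inl, v_apply_inr]

theorem h_u_left (x : Space n A) (i : Fin n) : h (u i) x = x (Sum.inr i) := by
  simp [h, u_apply_inl, u_apply_inr, apply_ite star]

/-- The map `v i ↦ v i + ∑ j, v j * x j` that fixes `v k` for `k ≠ i`, together with the
map of `M` adjoint to its inverse. -/
def transvectionMap (i : Fin n) (x : Fin n → A) : Space n A →ₗ[Aᵐᵒᵖ] Space n A where
  toFun z := Sum.elim
    (fun k => z (Sum.inl k) - if k = i then ∑ j, star (x j) * z (Sum.inl j) else 0)
    (fun k => z (Sum.inr k) + x k * z (Sum.inr i))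
  map_add' z w := by
    ext k
    rcases k with k | k
    · by_cases hk : k = i
      · simp [hk, mul_add, Finset.sum_add_distrib]
        abel
      · simp [hk]
    · simp [mul_add]
      abel
  map_smul' a z := by
    ext k
    rcases k with k | k
    · by_cases hk : k = i
      · simp [hk, sub_mul, Finset.sum_mul, mul_assoc]
      · simp [hk]
    · simp [mul_assoc]

@[simp] theorem transvectionMap_inl (i : Fin n) (x : Fin n → A) (z : Space n A) (k : Fin n) :
    transvectionMap i x z (Sum.inl k) =
      z (Sum.inl k) - if k = i then ∑ j, star (x j) * z (Sum.inl j) else 0 := rfl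

@[simp] theorem transvectionMap_inr (i : Fin n) (x : Fin n → A) (z : Space n A) (k : Fin n) :
    transvectionMap i x z (Sum.inr k) = z (Sum.inr k) + x k * z (Sum.inr i) := rfl

theorem transvectionMap_neg (i : Fin n) (x : Fin n → A) (hx : x i = 0) (z : Space n A) :
    transvectionMap i (-x) (transvectionMap i x z) = z := by
  ext k
  rcases k with k | k
  · by_cases hk : k = i
    · subst hk
      simp [mul_sub, hx]
    · simp [hk]
  · simp [hx]

/-- `transvectionMap` as an automorphism. -/
def transvection (i : Fin n) (x : Fin n → A) (hx : x i = 0) : GLSpace n A :=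
  LinearEquiv.ofLinearMap (transvectionMap i x) (transvectionMap i (-x))
    (LinearMap.ext fun z => by
      simpa using transvectionMap_neg i (-x) (by simp [hx]) z)
    (LinearMap.ext fun z => transvectionMap_neg i x hx z)

theorem transvection_apply (i : Fin n) (x : Fin n → A) (hx : x i = 0) (z : Space n A) :
    transvection i x hx z = transvectionMap i x z := rfl

theorem h_transvectionMap (i : Fin n) (x : Fin n → A) (hx : x i = 0) (y z : Space n A) :
    h (transvectionMap i x y) (transvectionMap i x z) = h y z := by
  have h1 : ∀ y z : Space n A, ∑ k, star (transvectionMap i x y (Sum.inl k)) *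
      transvectionMap i x z (Sum.inr k) = ∑ k, star (y (Sum.inl k)) * z (Sum.inr k) := by
    intro y z
    simp only [transvectionMap_inl, transvectionMap_inr, star_sub, apply_ite star, star_zero,
      sub_mul, mul_add, ite_mul, zero_mul, Finset.sum_sub_distrib, Finset.sum_add_distrib,
      Finset.sum_ite_eq', Finset.mem_univ, if_true, hx, mul_zero, star_sum, star_mul,
      star_star, Finset.sum_mul, mul_assoc, Finset.sum_const_zero]
    abel
  have h2 : ∀ y z : Space n A, h y z = ∑ k, star (y (Sum.inl k)) * z (Sum.inr k) -
      star (∑ k, star (z (Sum.inl k)) * y (Sum.inr k)) := by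
    intro y z
    simp [h, Finset.sum_sub_distrib, star_sum]
  rw [h2, h2, h1, h1]

theorem transvection_mem_L (i : Fin n) (x : Fin n → A) (hx : ∀ j ≤ i, x j = 0) :
    transvection i x (hx i le_rfl) ∈ L n A := by
  have hM : ∀ x : Fin n → A, ∀ z ∈ M n A, transvectionMap i x z ∈ M n A := by
    intro x z hz
    rw [mem_M_iff] at hz ⊢
    intro k
    simp [hz]
  have hN : ∀ x : Fin n → A, ∀ z ∈ N n A, transvectionMap i x z ∈ N n A := by
    intro x z hz
    rw [mem_N_iff] at hz ⊢
    intro k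
    simp [hz]
  have hxi := hx i le_rfl
  refine ⟨⟨h_transvectionMap i x hxi, fun z => ⟨fun hz => ?_, hM x z⟩,
    fun z => ⟨fun hz => ?_, hN x z⟩⟩, fun k => ?_⟩
  · have := hM (-x) _ hz
    rwa [transvection_apply, transvectionMap_neg i x hxi] at this
  · have := hN (-x) _ hz
    rwa [transvection_apply, transvectionMap_neg i x hxi] at this
  · have hval : transvection i x hxi (u k) - u k = MulOpposite.op (-star (x k)) • u i := by
      rw [transvection_apply]
      ext j
      rcases j with j | j
      · by_cases hj : j = i <;> simp [u_apply_inl, hj]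
      · simp [u_apply_inr]
    rw [hval]
    rcases le_or_gt k i with hki | hik
    · rw [hx k hki]
      simp
    · exact Submodule.smul_mem _ _ (u_mem_flag hik)

/-- The map `v i ↦ v i + u j * star a`, `v j ↦ v j + u i * a` (for `i ≠ j`) that fixes every other
basis vector: its hermitian matrix is the sum of `a` at `(i, j)` and `star a` at `(j, i)`. -/
def hermitianMap (i j : Fin n) (a : A) : Space n A →ₗ[Aᵐᵒᵖ] Space n A where
  toFun z := Sum.elim
    (fun k => z (Sum.inl k) + ((if k = i then a * z (Sum.inr j) else 0) +
      if k = j then star a * z (Sum.inr i) else 0))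
    (fun k => z (Sum.inr k))
  map_add' z w := by
    ext k
    rcases k with k | k
    · simp only [Sum.elim_inl, Pi.add_apply]
      split_ifs <;> simp [mul_add] <;> abel
    · simp
  map_smul' c z := by
    ext k
    rcases k with k | k
    · simp only [Sum.elim_inl, Pi.smul_apply, RingHom.id_apply]
      split_ifs <;> simp [mul_assoc]
    · simp

@[simp] theorem hermitianMap_inl (i j : Fin n) (a : A) (z : Space n A) (k : Fin n) :
    hermitianMap i j a z (Sum.inl k) = z (Sum.inl k) +
      ((if k = i then a * z (Sum.inr j) else 0) +
        if k = j then star a * z (Sum.inr i) else 0) := rfl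

@[simp] theorem hermitianMap_inr (i j : Fin n) (a : A) (z : Space n A) (k : Fin n) :
    hermitianMap i j a z (Sum.inr k) = z (Sum.inr k) := rfl

theorem hermitianMap_neg (i j : Fin n) (a : A) (z : Space n A) :
    hermitianMap i j (-a) (hermitianMap i j a z) = z := by
  ext k
  rcases k with k | k
  · simp only [hermitianMap_inl, hermitianMap_inr, star_neg, neg_mul]
    split_ifs <;> abel
  · simp

/-- `hermitianMap` as an automorphism. -/
def hermitianEquiv (i j : Fin n) (a : A) : GLSpace n A :=
  LinearEquiv.ofLinearMap (hermitianMap i j a) (hermitianMap i j (-a))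
    (LinearMap.ext fun z => by simpa using hermitianMap_neg i j (-a) z)
    (LinearMap.ext fun z => hermitianMap_neg i j a z)

theorem hermitianEquiv_apply (i j : Fin n) (a : A) (z : Space n A) :
    hermitianEquiv i j a z = hermitianMap i j a z := rfl

theorem hermitianEquiv_mem_C (i j : Fin n) (a : A) : hermitianEquiv i j a ∈ C n A := by
  refine ⟨fun y z => ?_, ?_⟩
  · rw [hermitianEquiv_apply, hermitianEquiv_apply]
    simp only [h, hermitianMap_inl, hermitianMap_inr, star_add, apply_ite star, star_zero,
      star_mul, star_star, add_mul, mul_add, ite_mul, mul_ite, zero_mul, mul_zero,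
      Finset.sum_sub_distrib, Finset.sum_add_distrib, Finset.sum_ite_eq', Finset.mem_univ, if_true,
      mul_assoc]
    abel
  · refine (mem_fixingSubgroup_iff _).2 fun z hz => ?_
    change hermitianMap i j a z = z
    have hz' := M_apply_inr hz
    ext k
    rcases k with k | k <;> simp [hz']

theorem h_hermitianEquiv {w : Space n A} (hw : w ∈ N n A) (i j : Fin n) (a : A) :
    h (hermitianEquiv i j a w) w =
      star (w (Sum.inr i)) * a * w (Sum.inr j) +
        star (star (w (Sum.inr i)) * a * w (Sum.inr j)) := by
  have hw' := mem_N_iff.1 hw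
  rw [hermitianEquiv_apply]
  simp only [h, hermitianMap_inl, hermitianMap_inr, hw', zero_add, mul_zero, sub_zero, star_add,
    apply_ite star, star_zero, star_mul, star_star, add_mul, ite_mul, zero_mul,
    Finset.sum_add_distrib, Finset.sum_ite_eq', Finset.mem_univ, if_true, mul_assoc]
  abel

/-! ### The decomposition of `P` and the orbit of `v i` -/

theorem conj_mem_C {l c : GLSpace n A} (hl : l ∈ L n A) (hc : c ∈ C n A) :
    l * c * l⁻¹ ∈ C n A := by
  refine ⟨mul_mem (mul_mem hl.1.1 hc.1) ((isometryGroup n A).inv_mem hl.1.1),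
    (mem_fixingSubgroup_iff _).2 ?_⟩
  intro z hz
  have h1 : l⁻¹ z ∈ M n A := (((L n A).inv_mem hl).1.2.1 z).2 hz
  have h2 : c (l⁻¹ z) = l⁻¹ z := (mem_fixingSubgroup_iff _).1 hc.2 _ h1
  change l (c (l⁻¹ z)) = z
  rw [h2, ← LinearEquiv.mul_apply, mul_inv_cancel, LinearEquiv.coe_one, id]

theorem exists_mul_of_mem_P {g : GLSpace n A} (hg : g ∈ P n A) :
    ∃ l ∈ L n A, ∃ c ∈ C n A, g = l * c := by
  have hle : L n A ≤ Subgroup.normalizer (C n A : Set (GLSpace n A)) :=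
    Subgroup.le_normalizer_iff.2 fun l hl c hc => conj_mem_C hl hc
  have hg' : g ∈ ((L n A ⊔ C n A : Subgroup (GLSpace n A)) : Set (GLSpace n A)) := by
    rw [sup_comm]
    exact hg
  rw [Subgroup.coe_mul_of_left_le_normalizer_right _ _ hle] at hg'
  obtain ⟨l, hl, c, hc, rfl⟩ := hg'
  exact ⟨l, hl, c, hc, rfl⟩

theorem apply_v_mem_orbitV {l : GLSpace n A} (hl : l ∈ L n A) (i : Fin n) :
    l (v i) ∈ orbitV A i := by
  have hl' := (L n A).inv_mem hl
  have key : ∀ k, l (v i) (Sum.inr k) = star (l⁻¹ (u k) (Sum.inl i)) := by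
    intro k
    have h1 := hl'.1.1 (u k) (l (v i))
    rw [← LinearEquiv.mul_apply l⁻¹ l, inv_mul_cancel, LinearEquiv.coe_one, id, h_v_right,
      h_u_left] at h1
    exact h1.symm
  have key2 : ∀ k ≤ i, l (v i) (Sum.inr k) = star ((u k : Space n A) (Sum.inl i)) := by
    intro k hk
    have h2 := flag_apply_inl hk (hl'.2 k)
    rw [Pi.sub_apply, sub_eq_zero] at h2
    rw [key, h2]
  refine ⟨(hl.1.2.2 _).2 (v_mem_orbitV i).1, ?_, fun k hk => ?_⟩
  · rw [key2 i le_rfl, u_apply_inl, if_pos rfl, star_one]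
  · rw [key2 k hk.le, u_apply_inl, if_neg hk.ne', star_zero]

theorem exists_transvection {i : Fin n} {w : Space n A} (hw : w ∈ orbitV A i) :
    ∃ l ∈ L n A, l (v i) = w ∧
      ∀ z ∈ N n A, z (Sum.inr i) = 0 → l z = z := by
  have hx : ∀ j ≤ i, w (Sum.inr j) - (v i : Space n A) (Sum.inr j) = 0 := by
    intro j hj
    rcases hj.lt_or_eq with hj | rfl
    · rw [hw.2.2 j hj, v_apply_inr, if_neg hj.ne, sub_zero]
    · rw [hw.2.1, v_apply_inr, if_pos rfl, sub_self]
  refine ⟨_, transvection_mem_L i (fun j => w (Sum.inr j) - (v i : Space n A) (Sum.inr j)) hx,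
    ?_, fun z hz hzi => ?_⟩
  · rw [transvection_apply]
    ext k
    rcases k with k | k
    · simp [v_apply_inl, mem_N_iff.1 hw.1]
    · simp [v_apply_inr]
  · rw [transvection_apply]
    ext k
    rcases k with k | k
    · simp [mem_N_iff.1 hz]
    · simp [hzi]

/-- `L` is transitive on families of vectors of the orbits `L (v i)`, for `i` in a finite set `s`:
the transvections that move `v i` to `w i` are multiplied in increasing order of `i`, so that each
fixes the vectors `w j`, `j > i`, already reached, and the vectors `v j`, `j < i`. -/
theorem exists_forall_apply_v (s : Finset (Fin n)) (w : Fin n → Space n A)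
    (hw : ∀ i, w i ∈ orbitV A i) :
    ∃ l ∈ L n A, (∀ i ∈ s, l (v i) = w i) ∧ ∀ i ∉ s, l (v i) = v i := by
  induction s using Finset.induction_on_min with
  | empty => exact ⟨1, one_mem _, by simp, fun i _ => rfl⟩
  | insert a s ha ih =>
    obtain ⟨l, hl, hs, hns⟩ := ih
    obtain ⟨t, ht, htv, htfix⟩ := exists_transvection (hw a)
    have has : a ∉ s := fun hmem => lt_irrefl _ (ha a hmem)
    refine ⟨t * l, mul_mem ht hl, fun i hi => ?_, fun i hi => ?_⟩
    · rw [LinearEquiv.mul_apply]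
      rcases Finset.mem_insert.1 hi with rfl | hi
      · rw [hns i has, htv]
      · rw [hs i hi, htfix _ (hw i).1 ((hw i).2.2 a (ha i hi))]
    · rw [Finset.mem_insert, not_or] at hi
      rw [LinearEquiv.mul_apply, hns i hi.2,
        htfix _ (v_mem_orbitV i).1 (by rw [v_apply_inr, if_neg (Ne.symm hi.1)])]

end HermitianUnipotent

namespace HermitianUnipotent

open Representation

variable {n : ℕ} {A : Type*} [Ring A] [StarRing A] {F : Type*} [Field F]

/-! ### The basis of `V i lam` indexed by the orbit of `v i` -/

/-- An element of `L` that maps `v i` to the vector `w` of its orbit. -/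
noncomputable def orbitRep (i : Fin n) (w : orbitV A i) : P n A :=
  ⟨(exists_transvection w.2).choose,
    le_sup_right (a := C n A) (exists_transvection w.2).choose_spec.1⟩

theorem orbitRep_mem_L (i : Fin n) (w : orbitV A i) : (orbitRep i w : GLSpace n A) ∈ L n A :=
  (exists_transvection w.2).choose_spec.1

theorem orbitRep_apply_v (i : Fin n) (w : orbitV A i) :
    (orbitRep i w : GLSpace n A) (v i) = w :=
  (exists_transvection w.2).choose_spec.2.1

theorem orbitRep_inv_apply (i : Fin n) (w : orbitV A i) :
    (orbitRep i w : GLSpace n A)⁻¹ w = v i := by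
  rw [← orbitRep_apply_v i w, ← LinearEquiv.mul_apply, inv_mul_cancel, LinearEquiv.coe_one, id]

theorem orbitRep_inv_mul_mem {i : Fin n} {w : orbitV A i} {l : GLSpace n A} (hl : l ∈ L n A)
    (hlw : l (v i) = w) : (orbitRep i w : GLSpace n A)⁻¹ * l ∈ Lstab (v i : Space n A) := by
  refine ⟨mul_mem ((L n A).inv_mem (orbitRep_mem_L i w)) hl, ?_⟩
  change ((orbitRep i w : GLSpace n A)⁻¹ * l) (v i) = v i
  rw [LinearEquiv.mul_apply, hlw, orbitRep_inv_apply]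

theorem C_le_CLstab (x : Space n A) : C n A ≤ CLstab x := le_sup_left

theorem Lstab_le_CLstab (x : Space n A) : Lstab x ≤ CLstab x := le_sup_right

/-- The elements `orbitRep i w` form a transversal of `C ⋊ L_{vᵢ}` in `P`. They represent distinct
cosets because `w` is recovered modulo `M` from the image of `v i`, and every coset because `L`
normalizes `C`. -/
theorem orbitRep_bijective (i : Fin n) : Function.Bijective
    fun p : orbitV A i × CLstab (v i : Space n A) =>
      orbitRep i p.1 * Subgroup.inclusion (CLstab_le_P (v i : Space n A)) p.2 := by
  constructor
  · rintro ⟨w, t⟩ ⟨w', t'⟩ heq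
    have happly : (orbitRep i w : GLSpace n A) ((t : GLSpace n A) (v i)) =
        (orbitRep i w' : GLSpace n A) ((t' : GLSpace n A) (v i)) :=
      LinearEquiv.congr_fun (congrArg Subtype.val heq) (v i)
    have key : ∀ (w : orbitV A i) (t : CLstab (v i : Space n A)) (k : Fin n),
        (orbitRep i w : GLSpace n A) ((t : GLSpace n A) (v i)) (Sum.inr k) =
          (w : Space n A) (Sum.inr k) := by
      intro w t k
      have h1 := ((orbitRep_mem_L i w).1.2.1 _).2 (CLstab_spec _ t.2).2.2
      have h2 := M_apply_inr h1 k
      rwa [map_sub, orbitRep_apply_v, Pi.sub_apply, sub_eq_zero] at h2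
    have hw : w = w' := by
      apply Subtype.ext
      ext k
      rcases k with k | k
      · rw [mem_N_iff.1 w.2.1, mem_N_iff.1 w'.2.1]
      · rw [← key w t, happly, key]
    subst hw
    exact Prod.ext rfl (Subgroup.inclusion_injective _ (mul_left_cancel heq))
  · intro g
    obtain ⟨l, hl, c, hc, hg⟩ := exists_mul_of_mem_P g.2
    set w : orbitV A i := ⟨l (v i), apply_v_mem_orbitV hl i⟩
    have ht : (orbitRep i w : GLSpace n A)⁻¹ * l * c ∈ CLstab (v i : Space n A) :=
      mul_mem (Lstab_le_CLstab _ (orbitRep_inv_mul_mem hl rfl)) (C_le_CLstab _ hc)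
    refine ⟨⟨w, ⟨_, ht⟩⟩, Subtype.ext ?_⟩
    change (orbitRep i w : GLSpace n A) * ((orbitRep i w : GLSpace n A)⁻¹ * l * c) = g
    rw [hg, mul_assoc, mul_inv_cancel_left]

theorem W_apply (i : Fin n) (lam : AddChar A Fˣ) (t : CLstab (v i : Space n A)) (a : F) :
    W i lam t a = chi i lam t * a := rfl

/-- The basis of `V i lam` indexed by the orbit of `v i`: the vector at `w` is `l ⊗ 1` for any
`l` in `L` with `l (v i) = w`. -/
noncomputable def basisV (i : Fin n) (lam : AddChar A Fˣ) :
    Module.Basis (orbitV A i) F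
      (IndV (Subgroup.inclusion (CLstab_le_P (v i : Space n A))) (W i lam)) :=
  IndV.basis _ (W_apply i lam) (Equiv.ofBijective _ (orbitRep_bijective i))
    (orbitRep i) fun _ _ => rfl

theorem V_basisV (i : Fin n) (lam : AddChar A Fˣ) {g : P n A} {w w' : orbitV A i}
    {t : GLSpace n A} (ht : t ∈ CLstab (v i : Space n A))
    (hg : (g : GLSpace n A) * orbitRep i w = orbitRep i w' * t) :
    V i lam g (basisV i lam w) = (lam (h (t (v i)) (v i)) : F) • basisV i lam w' :=
  ind_basis (Subgroup.inclusion (CLstab_le_P (v i : Space n A))) (W_apply i lam)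
    (Equiv.ofBijective _ (orbitRep_bijective i)) (orbitRep i) (fun _ _ => rfl) (t := ⟨t, ht⟩)
    (Subtype.ext hg)

/-- The vector at `w` is a weight vector for `C`. -/
theorem V_basisV_of_mem_C (i : Fin n) (lam : AddChar A Fˣ) {c : P n A}
    (hc : (c : GLSpace n A) ∈ C n A) (w : orbitV A i) :
    V i lam c (basisV i lam w) =
      (lam (h ((c : GLSpace n A) w) w) : F) • basisV i lam w := by
  have hl := orbitRep_mem_L i w
  have ht := conj_mem_C ((L n A).inv_mem hl) hc
  rw [inv_inv] at ht
  have h1 := ((L n A).inv_mem hl).1.1 ((c : GLSpace n A) w) w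
  rw [orbitRep_inv_apply] at h1
  rw [V_basisV i lam (w' := w) (C_le_CLstab _ ht) (by rw [mul_assoc, mul_inv_cancel_left]), ← h1,
    LinearEquiv.mul_apply, LinearEquiv.mul_apply, orbitRep_apply_v]

theorem V_basisV_of_mem_L (i : Fin n) (lam : AddChar A Fˣ) {l : P n A}
    (hl : (l : GLSpace n A) ∈ L n A) {w : orbitV A i} (hlw : (l : GLSpace n A) (v i) = w) :
    V i lam l (basisV i lam ⟨v i, v_mem_orbitV i⟩) = basisV i lam w := by
  have h0 := orbitRep_apply_v i (⟨v i, v_mem_orbitV i⟩ : orbitV A i)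
  have ht := orbitRep_inv_mul_mem (w := w)
    (mul_mem hl (orbitRep_mem_L i ⟨v i, v_mem_orbitV i⟩))
    (by rw [LinearEquiv.mul_apply, h0, hlw])
  have hv : _ = (v i : Space n A) := ht.2
  rw [V_basisV i lam (w' := w) (Lstab_le_CLstab _ ht) (by rw [mul_inv_cancel_left])]
  refine (congrArg (fun z => (lam (h z (v i)) : F) • basisV i lam w) hv).trans ?_
  rw [h_v_self, AddChar.map_zero_eq_one, Units.val_one, one_smul]

/-! ### The weights of `C` on the tensor product -/

/-- The weight of `C` on the tensor product of the basis vectors at `w i`, `i ∈ D`. -/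
def weight {D : Finset (Fin n)} (lam : D → AddChar A Fˣ) (w : ∀ i : D, orbitV A i.1)
    (c : GLSpace n A) : Fˣ :=
  ∏ i, lam i (h (c (w i)) (w i))

/-- Left admissibility separates the weights. If `w` and `w'` agree before `i`, then evaluating
both weights at the hermitian matrices with entries `a` at `(i, j)` and `star a` at `(j, i)`, where
`j > i`, leaves only the factors at `i`, since the later vectors have no `i`-th coordinate. These
are the values of `sharp (lam i)` at `a` times the `j`-th coordinates of `w i` and `w' i`. -/
theorem weight_injective {D : Finset (Fin n)} {lam : D → AddChar A Fˣ}
    (hlam : ∀ i, LeftAdmissible (lam i)) {w w' : ∀ i : D, orbitV A i.1}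
    (hw : ∀ c ∈ C n A, weight lam w c = weight lam w' c) : w = w' := by
  funext i
  induction i using WellFoundedLT.induction with
  | ind i ih =>
    have hcoord : ∀ (x : orbitV A i.1) (a : A) (j : Fin n),
        lam i (h (hermitianEquiv i.1 j a (x : Space n A)) x) =
          sharp (lam i) (a * (x : Space n A) (Sum.inr j)) := by
      intro x a j
      rw [h_hermitianEquiv x.2.1, x.2.2.1, star_one, one_mul]
      rfl
    have hlate : ∀ (k : D) (x : orbitV A k.1) (a : A) (j : Fin n), i < k →
        lam k (h (hermitianEquiv i.1 j a (x : Space n A)) x) = 1 := by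
      intro k x a j hik
      rw [h_hermitianEquiv x.2.1, x.2.2.2 i.1 hik, star_zero, zero_mul, zero_mul, star_zero,
        add_zero, AddChar.map_zero_eq_one]
    have hfactor : ∀ (a : A) (j : Fin n),
        sharp (lam i) (a * (w i : Space n A) (Sum.inr j)) =
          sharp (lam i) (a * (w' i : Space n A) (Sum.inr j)) := by
      intro a j
      have h1 := hw _ (hermitianEquiv_mem_C i.1 j a)
      rw [weight, weight, ← Finset.mul_prod_erase _ _ (Finset.mem_univ i),
        ← Finset.mul_prod_erase (a := i) _ (fun k => lam k (h _ (w' k : Space n A)))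
          (Finset.mem_univ i), hcoord, hcoord] at h1
      refine mul_right_cancel (h1.trans (congrArg _ (Finset.prod_congr rfl fun k hk => ?_)))
      rcases lt_or_gt_of_ne (Finset.ne_of_mem_erase hk) with hki | hik
      · rw [ih k hki]
      · rw [hlate k _ a j hik, hlate k _ a j hik]
    apply Subtype.ext
    ext j
    rcases j with j | j
    · rw [mem_N_iff.1 (w i).2.1, mem_N_iff.1 (w' i).2.1]
    · have hI := hlam i
        (Ideal.span {(w i : Space n A) (Sum.inr j) - (w' i : Space n A) (Sum.inr j)}) (by
          intro b hb
          obtain ⟨a, rfl⟩ := Ideal.mem_span_singleton'.1 hb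
          rw [mul_sub, AddChar.map_sub_eq_div, hfactor, div_self'])
      exact sub_eq_zero.1 (Ideal.span_singleton_eq_bot.1 hI)

/-- The tensor products of the basis vectors of the factors. -/
noncomputable def basisVD (D : Finset (Fin n)) (lam : D → AddChar A Fˣ) :
    Module.Basis (∀ i : D, orbitV A i.1) F (PiTensorProduct F fun i : D =>
      IndV (Subgroup.inclusion (CLstab_le_P (v i.1 : Space n A))) (W i.1 (lam i))) :=
  Basis.piTensorProduct fun i => basisV i.1 (lam i)

theorem VD_basisVD (D : Finset (Fin n)) (lam : D → AddChar A Fˣ) (g : P n A)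
    (w : ∀ i : D, orbitV A i.1) :
    VD D lam g (basisVD D lam w) =
      PiTensorProduct.tprod F fun i => V i.1 (lam i) g (basisV i.1 (lam i) (w i)) := by
  rw [basisVD, Basis.piTensorProduct_apply]
  exact PiTensorProduct.map_tprod _ _

theorem VD_basisVD_of_mem_C (D : Finset (Fin n)) (lam : D → AddChar A Fˣ) {c : P n A}
    (hc : (c : GLSpace n A) ∈ C n A) (w : ∀ i : D, orbitV A i.1) :
    VD D lam c (basisVD D lam w) = (weight lam w c : F) • basisVD D lam w := by
  rw [VD_basisVD]
  simp_rw [V_basisV_of_mem_C _ _ hc]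
  rw [MultilinearMap.map_smul_univ, basisVD, Basis.piTensorProduct_apply, weight,
    Units.coe_prod]

/-- Any basis vector is reached from the one at `(v i)`, `i ∈ D`, because `L` moves the vectors
`v i` independently. -/
theorem exists_VD_basisVD (D : Finset (Fin n)) (lam : D → AddChar A Fˣ)
    (w : ∀ i : D, orbitV A i.1) :
    ∃ g, VD D lam g (basisVD D lam fun i => ⟨v i.1, v_mem_orbitV i.1⟩) = basisVD D lam w := by
  classical
  obtain ⟨l, hl, hs, -⟩ := exists_forall_apply_v D
    (fun i => if hi : i ∈ D then (w ⟨i, hi⟩ : Space n A) else v i) (fun i => by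
      split_ifs with hi
      · exact (w ⟨i, hi⟩).2
      · exact v_mem_orbitV i)
  refine ⟨⟨l, le_sup_right (a := C n A) hl⟩, ?_⟩
  rw [VD_basisVD, basisVD, Basis.piTensorProduct_apply]
  congr 1
  funext i
  exact V_basisV_of_mem_L i.1 (lam i) hl (by rw [hs i.1 i.2, dif_pos i.2])

end HermitianUnipotent

theorem theorem5p1 {A : Type*} [Ring A] [Nontrivial A] [StarRing A] {F : Type*} [Field F]
    (n : ℕ) (D : Finset (Fin n)) (hD : D.Nonempty)
    (lam : D → AddChar A Fˣ) (hlam : ∀ i : D, HermitianUnipotent.LeftAdmissible (lam i)) :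
    (HermitianUnipotent.VD D lam).IsIrreducible ∧
      Module.rank F (Representation.IntertwiningMap (HermitianUnipotent.VD D lam)
        (HermitianUnipotent.VD D lam)) = 1 := by
  have hχ : ∀ c ∈ {c : HermitianUnipotent.P n A | (c : HermitianUnipotent.GLSpace n A) ∈
      HermitianUnipotent.C n A}, ∀ w, HermitianUnipotent.VD D lam c
        (HermitianUnipotent.basisVD D lam w) =
      (HermitianUnipotent.weight lam w c : F) • HermitianUnipotent.basisVD D lam w :=
    fun c hc w => HermitianUnipotent.VD_basisVD_of_mem_C D lam hc w
  have hinj : ∀ w w', (∀ c ∈ {c : HermitianUnipotent.P n A |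
      (c : HermitianUnipotent.GLSpace n A) ∈ HermitianUnipotent.C n A},
      (HermitianUnipotent.weight lam w c : F) = HermitianUnipotent.weight lam w' c) → w = w' :=
    fun w w' hw => HermitianUnipotent.weight_injective hlam fun c hc =>
      Units.ext (hw ⟨c, le_sup_left (b := HermitianUnipotent.L n A) hc⟩ hc)
  have htrans := HermitianUnipotent.exists_VD_basisVD D lam
  exact ⟨Representation.isIrreducible_of_weights _ hχ hinj _ htrans,
    Representation.rank_intertwiningMap_of_weights _ hχ hinj _ htrans⟩
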